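/- Consider a stochastic bandit with actions $1,\dots,K$, where the rewards of action $i$ are drawn independently over rounds from a fixed distribution $\nu_i$ on $[0,1]$ with mean $\mu_i$. Put $\mu_*=\max_i\mu_i$ and $\Delta(i)=\mu_*-\mu_i$. In round $t=1,\dots,T$ the learner chooses an action $i_t$, a true reward $r_t(i_t)\sim\nu_{i_t}$ is drawn, and a strong attacker, who knows everything that has happened so far (including $i_t$ and $r_t(i_t)$) and may use internal randomness, adds a contamination $\epsilon_t$ with $r_t(i_t)+\epsilon_t\in[0,1]$; the learner observes only $r_t(i_t)+\epsilon_t$. Classical UCB plays $i_t=t$ for $t\le K$, and for $t>K$ plays an action that maximizes $\hat\mu_{t-1}(i)+\sqrt{8\log t/N_{t-1}(i)}$ (ties broken arbitrarily without knowledge of future rewards), where $N_{t-1}(i)$ is the number of times that $i$ was chosen in rounds $1,\dots,t-1$ and $\hat\mu_{t-1}(i)$ is the mean of the rewards observed for $i$ in these rounds. Its regret is $R^{UCB}(T)=T\mu_*-\mathbb E\big[\sum_{t=1}^T r_t(i_t)\big]$, and its total contamination is $\sum_{t=1}^T|\epsilon_t|$. **Theorem.** (a) There is a universal constant $c_1>0$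 such that the following holds. Let $0<\varepsilon<1$ and $\alpha>0$ with $\varepsilon\alpha\le 1/2$, let $t_0>0$, $t_0\neq 1$, satisfy $t_0/(\log t_0)^2\ge 36K^2$, and let $T>\max\{t_0^{1/(1-\alpha\varepsilon)},\exp(4^\alpha)\}$. If the total contamination is almost surely at most $(\log T)^{1-\varepsilon}$, then $$R^{UCB}(T)\le c_1\Big(T^{1-\alpha\varepsilon}\max_i\Delta(i)+\sum_{i:\,\Delta(i)>0}\frac{\log T}{\Delta(i)}\Big).$$ (b) Fix $0<\varepsilon<1$, $K$ and $\nu_1,\dots,\nu_K$. If for every horizon $T$ UCB faces an attacker (who may depend on $T$) whose total contamination is, for all large $T$, almost surely at most $(\log T)^{1-\varepsilon}$, then $R^{UCB}(T)=o(T)$ as $T\to\infty$. (c) The same holds if the total contamination is, for all large $T$, almost surely at most $C(T)$, for any $C(T)=o(\log T)$: then $R^{UCB}(T)=o(T)$. In particular such an attack is not successful, i.e. it does not make the regret $\Omega(T)$. -/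

import Mathlib

open MeasureTheory ProbabilityTheory Filter Asymptotics

namespace PoisonedBandit

noncomputable section

/-- The expected reward `μ_i` of action `i`, whose rewards are distributed according to `ν i`. -/
def mean {K : ℕ} (ν : Fin K → Measure ℝ) (i : Fin K) : ℝ := ∫ x, x ∂(ν i)

/-- The expected reward of an optimal action. -/
def bestMean {K : ℕ} (ν : Fin K → Measure ℝ) : ℝ := ⨆ i, mean ν i

/-- The gap `Δ(i)` between the expected rewards of an optimal action and of action `i`. -/
def gap {K : ℕ} (ν : Fin K → Measure ℝ) (i : Fin K) : ℝ := bestMean ν - mean ν i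

/-- An interaction of `T` rounds (numbered `1, …, T`) between a learner, the environment with reward
distributions `ν` and an attacker.  The σ-algebra `𝓕 t` is the information available after
round `t`; `𝓕 0` may hold internal randomness of the learner and of the attacker.
The learner chooses `action t` before the rewards of round `t` are drawn; the attacker chooses
the contamination `noise t` of the reward of the chosen action afterwards. -/
structure Interaction {K : ℕ} (ν : Fin K → Measure ℝ) (T : ℕ) {Ω : Type*} [MeasurableSpace Ω]
    (P : Measure Ω) where
  /-- The information available after each round. -/
  𝓕 : Filtration ℕ ‹MeasurableSpace Ω›
  /-- The true reward `r_t(i)`. -/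
  reward : ℕ → Ω → Fin K → ℝ
  /-- The chosen action `i_t`. -/
  action : ℕ → Ω → Fin K
  /-- The contamination `ε_t(i_t)`. -/
  noise : ℕ → Ω → ℝ
  measurable_action : ∀ t ∈ Finset.Icc 1 T, Measurable[𝓕 (t - 1)] (action t)
  measurable_reward : ∀ t ∈ Finset.Icc 1 T, Measurable[𝓕 t] (reward t)
  measurable_noise : ∀ t ∈ Finset.Icc 1 T, Measurable[𝓕 t] (noise t)
  reward_law : ∀ t ∈ Finset.Icc 1 T, ∀ i, P.map (fun ω => reward t ω i) = ν i
  reward_indep : ∀ t ∈ Finset.Icc 1 T,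
    Indep (MeasurableSpace.comap (reward t) inferInstance) (𝓕 (t - 1)) P
  observed_mem : ∀ t ∈ Finset.Icc 1 T,
    ∀ᵐ ω ∂P, reward t ω (action t ω) + noise t ω ∈ Set.Icc (0 : ℝ) 1

namespace Interaction

variable {K : ℕ} {ν : Fin K → Measure ℝ} {T : ℕ} {Ω : Type*} [MeasurableSpace Ω] {P : Measure Ω}

/-- The true reward `r_t(i_t)` of the chosen action. -/
def trueReward (A : Interaction ν T P) (t : ℕ) (ω : Ω) : ℝ := A.reward t ω (A.action t ω)

/-- The observed reward `r_t(i_t) + ε_t(i_t)`. -/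
def observed (A : Interaction ν T P) (t : ℕ) (ω : Ω) : ℝ := A.trueReward t ω + A.noise t ω

/-- The number `N_t(i)` of rounds up to and including round `t` in which `i` is chosen. -/
def pulls (A : Interaction ν T P) (t : ℕ) (i : Fin K) (ω : Ω) : ℕ :=
  ((Finset.Icc 1 t).filter (fun n => A.action n ω = i)).card

/-- The empirical mean of the observed rewards of action `i` until round `t`. -/
def empMean (A : Interaction ν T P) (t : ℕ) (i : Fin K) (ω : Ω) : ℝ :=
  (∑ n ∈ Finset.Icc 1 t, if A.action n ω = i then A.observed n ω else 0) / (A.pulls t i ω : ℝ)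

/-- The upper confidence bound of action `i` that is used for the choice in round `t`. -/
def ucbIndex (A : Interaction ν T P) (t : ℕ) (i : Fin K) (ω : Ω) : ℝ :=
  A.empMean (t - 1) i ω + Real.sqrt (8 * Real.log (t : ℝ) / (A.pulls (t - 1) i ω : ℝ))

/-- The learner runs the classical UCB algorithm: in the first `K` rounds it takes the actions one
after the other, and from then on an action with the largest upper confidence bound
(ties are broken arbitrarily). -/
structure IsUCB (A : Interaction ν T P) : Prop where
  roundRobin : ∀ t ∈ Finset.Icc 1 T, t ≤ K → ∀ ω, (A.action t ω : ℕ) + 1 = t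
  argmax : ∀ t ∈ Finset.Icc 1 T, K < t → ∀ ω j, A.ucbIndex t j ω ≤ A.ucbIndex t (A.action t ω) ω

/-- The total amount of contamination. -/
def contamination (A : Interaction ν T P) (ω : Ω) : ℝ := ∑ t ∈ Finset.Icc 1 T, |A.noise t ω|

/-- The (expected) regret over the `T` rounds, measured in true rewards. -/
def regret (A : Interaction ν T P) : ℝ :=
  (T : ℝ) * bestMean ν - ∫ ω, ∑ t ∈ Finset.Icc 1 T, A.trueReward t ω ∂P

end Interaction

/-- An attack (one for each horizon `T`) is successful if it makes the regret `Ω(T)`. -/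
def SuccessfulAttack (R : ℕ → ℝ) : Prop := ∃ c : ℝ, 0 < c ∧ ∀ᶠ T : ℕ in atTop, c * (T : ℝ) ≤ R T

end

end PoisonedBandit

namespace PoisonedBandit

/-! All three claims reduce to one statement: a contamination of at most `Λ = log T` does not hurt
UCB in rounds `t ≥ √T`. There `Λ/2 ≤ log t ≤ Λ`, so with `x = √(Λ/N)` the exploration bonus of an
action chosen `N` times lies between `2x` and `3x`. The attacker shifts an empirical mean by at most
`Λ/N = x²`, and sampling noise is at most `3/2 x` outside an event of probability `O(T⁻³)` per
action. For `x ≤ 1/2` the total error is therefore at most `2x`, which the bonus absorbs. So an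
optimal index stays above the best mean (`bestMean_le_ucbIndex`), and a suboptimal action with gap
`Δ` is not chosen once `6x < Δ`, that is, after `36 Λ/Δ²` pulls (`IsUCB.pulls_action_le`).

The rounds before a threshold `s ≥ √T` are charged the maximal gap. This gives `IsUCB.regret_le`;
part (a) takes `s = T^(1-αε)`, the asymptotic parts take `s = √T`. Concentration has to survive
adaptive choices, hence the exponential supermartingale `lintegral_exp_deviation_le` and a union
bound over rounds and pull counts. -/

lemma le_bestMean {K : ℕ} (ν : Fin K → Measure ℝ) (i : Fin K) : mean ν i ≤ bestMean ν :=
  le_ciSup (Set.finite_range _).bddAbove i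

lemma gap_nonneg {K : ℕ} (ν : Fin K → Measure ℝ) (i : Fin K) : 0 ≤ gap ν i :=
  sub_nonneg.2 (le_bestMean ν i)

lemma gap_le_iSup {K : ℕ} (ν : Fin K → Measure ℝ) (i : Fin K) : gap ν i ≤ ⨆ j, gap ν j :=
  le_ciSup (Set.finite_range _).bddAbove i

lemma iSup_gap_nonneg {K : ℕ} (ν : Fin K → Measure ℝ) : 0 ≤ ⨆ j, gap ν j :=
  Real.iSup_nonneg (gap_nonneg ν)

lemma mean_mem_Icc {K : ℕ} {ν : Fin K → Measure ℝ} (hp : ∀ i, IsProbabilityMeasure (ν i))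
    (hν : ∀ i, ∀ᵐ x ∂(ν i), x ∈ Set.Icc (0 : ℝ) 1) (i : Fin K) : mean ν i ∈ Set.Icc (0 : ℝ) 1 := by
  have := hp i
  refine ⟨integral_nonneg_of_ae ((hν i).mono fun x hx => hx.1), ?_⟩
  have h := integral_mono_ae (Integrable.of_mem_Icc 0 1 aemeasurable_id (hν i))
    (integrable_const (1 : ℝ)) ((hν i).mono fun x hx => hx.2)
  simpa [mean] using h

lemma gap_le_one {K : ℕ} {ν : Fin K → Measure ℝ} (hp : ∀ i, IsProbabilityMeasure (ν i))
    (hν : ∀ i, ∀ᵐ x ∂(ν i), x ∈ Set.Icc (0 : ℝ) 1) (i : Fin K) : gap ν i ≤ 1 := by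
  have : Nonempty (Fin K) := ⟨i⟩
  have h : bestMean ν ≤ 1 := ciSup_le fun j => (mean_mem_Icc hp hν j).2
  have := (mean_mem_Icc hp hν i).1
  unfold gap
  linarith

namespace Interaction

variable {K : ℕ} {ν : Fin K → Measure ℝ} {T : ℕ} {Ω : Type*} [MeasurableSpace Ω] {P : Measure Ω}

/-! ### Pull counts and deviation sums: recursion and measurability. -/

/-- The sum of the deviations from the mean of the true rewards of action `i` in the rounds up to
and including `t` in which `i` is chosen. -/
noncomputable def deviation (A : Interaction ν T P) (t : ℕ) (i : Fin K) (ω : Ω) : ℝ :=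
  ∑ n ∈ Finset.Icc 1 t, if A.action n ω = i then A.reward n ω i - mean ν i else 0

lemma pulls_eq_sum (A : Interaction ν T P) (t : ℕ) (i : Fin K) (ω : Ω) :
    A.pulls t i ω = ∑ n ∈ Finset.Icc 1 t, if A.action n ω = i then 1 else 0 :=
  Finset.card_filter _ _

lemma pulls_succ (A : Interaction ν T P) (t : ℕ) (i : Fin K) (ω : Ω) :
    A.pulls (t + 1) i ω = A.pulls t i ω + if A.action (t + 1) ω = i then 1 else 0 := by
  simp only [pulls_eq_sum]
  exact Finset.sum_Icc_succ_top (by omega) _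

lemma deviation_succ (A : Interaction ν T P) (t : ℕ) (i : Fin K) (ω : Ω) :
    A.deviation (t + 1) i ω = A.deviation t i ω +
      if A.action (t + 1) ω = i then A.reward (t + 1) ω i - mean ν i else 0 :=
  Finset.sum_Icc_succ_top (by omega) _

lemma pulls_le (A : Interaction ν T P) (t : ℕ) (i : Fin K) (ω : Ω) : A.pulls t i ω ≤ t := by
  simpa [pulls] using Finset.card_filter_le (Finset.Icc 1 t) (fun n => A.action n ω = i)

lemma measurableSet_action_eq (A : Interaction ν T P) {n : ℕ} (hn : n ∈ Finset.Icc 1 T)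
    (i : Fin K) : MeasurableSet[A.𝓕 (n - 1)] {ω | A.action n ω = i} :=
  A.measurable_action n hn (measurableSet_singleton i)

lemma measurable_reward_apply (A : Interaction ν T P) {n : ℕ} (hn : n ∈ Finset.Icc 1 T)
    (i : Fin K) : Measurable[A.𝓕 n] fun ω => A.reward n ω i :=
  (measurable_pi_apply i).comp (A.measurable_reward n hn)

lemma measurable_pulls (A : Interaction ν T P) {t : ℕ} (ht : t ≤ T) (i : Fin K) :
    Measurable[A.𝓕 t] (A.pulls t i) := by
  have : A.pulls t i = fun ω => ∑ n ∈ Finset.Icc 1 t, if A.action n ω = i then 1 else 0 :=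
    funext (A.pulls_eq_sum t i)
  rw [this]
  refine Finset.measurable_fun_sum _ fun n hn => ?_
  rw [Finset.mem_Icc] at hn
  refine Measurable.ite ?_ measurable_const measurable_const
  exact A.𝓕.mono (by omega) _ (A.measurableSet_action_eq (Finset.mem_Icc.2 ⟨hn.1, by omega⟩) i)

lemma measurable_deviation (A : Interaction ν T P) {t : ℕ} (ht : t ≤ T) (i : Fin K) :
    Measurable[A.𝓕 t] (A.deviation t i) := by
  refine Finset.measurable_fun_sum _ fun n hn => ?_
  rw [Finset.mem_Icc] at hn
  have hn' : n ∈ Finset.Icc 1 T := Finset.mem_Icc.2 ⟨hn.1, by omega⟩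
  refine Measurable.ite ?_ ?_ measurable_const
  · exact A.𝓕.mono (by omega) _ (A.measurableSet_action_eq hn' i)
  · exact ((A.measurable_reward_apply hn' i).mono (A.𝓕.mono hn.2) le_rfl).sub measurable_const

lemma reward_mem_Icc (A : Interaction ν T P) (hν : ∀ i, ∀ᵐ x ∂(ν i), x ∈ Set.Icc (0 : ℝ) 1)
    {n : ℕ} (hn : n ∈ Finset.Icc 1 T) (i : Fin K) :
    ∀ᵐ ω ∂P, A.reward n ω i ∈ Set.Icc (0 : ℝ) 1 := by
  have h := hν i
  rw [← A.reward_law n hn i] at h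
  exact ae_of_ae_map ((A.measurable_reward_apply hn i).mono (A.𝓕.le n) le_rfl).aemeasurable h

lemma integral_reward (A : Interaction ν T P) {n : ℕ} (hn : n ∈ Finset.Icc 1 T) (i : Fin K) :
    ∫ ω, A.reward n ω i ∂P = mean ν i := by
  rw [mean, ← A.reward_law n hn i, integral_map]
  · exact ((A.measurable_reward_apply hn i).mono (A.𝓕.le n) le_rfl).aemeasurable
  · exact aestronglyMeasurable_id

/-! ### Concentration of the true rewards under adaptive sampling. -/

/-- Hoeffding's lemma: a variable in an interval of length 1 is sub-Gaussian with variance proxy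
`1/4`. -/
lemma lintegral_exp_reward_le [IsProbabilityMeasure P] (A : Interaction ν T P)
    (hν : ∀ i, ∀ᵐ x ∂(ν i), x ∈ Set.Icc (0 : ℝ) 1)
    {n : ℕ} (hn : n ∈ Finset.Icc 1 T) (i : Fin K) (l : ℝ) :
    ∫⁻ ω, ENNReal.ofReal (Real.exp (l * (A.reward n ω i - mean ν i) - l ^ 2 / 8)) ∂P ≤ 1 := by
  have hm : AEMeasurable (fun ω => A.reward n ω i) P :=
    ((A.measurable_reward_apply hn i).mono (A.𝓕.le n) le_rfl).aemeasurable
  have h := hasSubgaussianMGF_of_mem_Icc hm (A.reward_mem_Icc hν hn i)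
  rw [A.integral_reward hn i] at h
  have hle := h.mgf_le l
  have hint := h.integrable_exp_mul l
  simp only [Real.exp_sub, div_eq_mul_inv _ (Real.exp _)]
  rw [← ofReal_integral_eq_lintegral_ofReal (hint.mul_const _)
    (ae_of_all _ fun ω => by positivity), integral_mul_const]
  refine ENNReal.ofReal_le_one.2 ?_
  rw [← div_eq_mul_inv, div_le_one (Real.exp_pos _)]
  refine hle.trans (Real.exp_le_exp.2 (le_of_eq ?_))
  norm_num
  ring

/-- The exponential process of the deviations of action `i` is a supermartingale. -/
lemma lintegral_exp_deviation_le [IsProbabilityMeasure P] (A : Interaction ν T P)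
    (hν : ∀ i, ∀ᵐ x ∂(ν i), x ∈ Set.Icc (0 : ℝ) 1) (i : Fin K) (l : ℝ) {t : ℕ} (ht : t ≤ T) :
    ∫⁻ ω, ENNReal.ofReal (Real.exp (l * A.deviation t i ω - l ^ 2 / 8 * A.pulls t i ω)) ∂P ≤ 1 := by
  induction t with
  | zero => simp [deviation, pulls]
  | succ t ih =>
    have hn : t + 1 ∈ Finset.Icc 1 T := Finset.mem_Icc.2 ⟨by omega, ht⟩
    set W : Ω → ENNReal := fun ω =>
      ENNReal.ofReal (Real.exp (l * A.deviation t i ω - l ^ 2 / 8 * A.pulls t i ω)) with hW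
    set g : Ω → ENNReal := fun ω =>
      ENNReal.ofReal (Real.exp (l * (A.reward (t + 1) ω i - mean ν i) - l ^ 2 / 8)) with hg
    set s : Set Ω := {ω | A.action (t + 1) ω = i} with hs
    have hsm : MeasurableSet[A.𝓕 t] s := A.measurableSet_action_eq hn i
    have hWm : Measurable[A.𝓕 t] W := by
      refine ENNReal.measurable_ofReal.comp (Real.measurable_exp.comp (Measurable.sub ?_ ?_))
      · exact (A.measurable_deviation (by omega) i).const_mul _
      · exact (measurable_from_top.comp (A.measurable_pulls (by omega) i)).const_mul _
    have hgm : Measurable[MeasurableSpace.comap (A.reward (t + 1)) inferInstance] g := by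
      have : Measurable fun x : Fin K → ℝ =>
          ENNReal.ofReal (Real.exp (l * (x i - mean ν i) - l ^ 2 / 8)) := by fun_prop
      exact this.comp (comap_measurable _)
    have hle : MeasurableSpace.comap (A.reward (t + 1)) inferInstance ≤ ‹MeasurableSpace Ω› :=
      ((A.measurable_reward _ hn).mono (A.𝓕.le _) le_rfl).comap_le
    -- The process changes only where `i` is chosen. That event is known after round `t` while the
    -- new reward is independent of `𝓕 t`, so the expectation of the product factors.
    have hsplit : ∀ ω, ENNReal.ofReal (Real.exp (l * A.deviation (t + 1) i ω -
        l ^ 2 / 8 * A.pulls (t + 1) i ω)) = sᶜ.indicator W ω + s.indicator W ω * g ω := by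
      intro ω
      rw [deviation_succ, pulls_succ]
      by_cases h : A.action (t + 1) ω = i
      · have h' : ω ∈ s := h
        simp only [h, if_true, Set.indicator_of_mem h', Set.indicator_of_notMem
          (Set.notMem_compl_iff.2 h'), zero_add, hW, hg]
        rw [← ENNReal.ofReal_mul (Real.exp_pos _).le, ← Real.exp_add]
        congr 2
        push_cast
        ring
      · have h' : ω ∉ s := h
        simp [h, h', hW]
    simp only [hsplit]
    rw [lintegral_add_left' ((hWm.indicator hsm.compl).mono (A.𝓕.le t) le_rfl).aemeasurable,
      lintegral_mul_eq_lintegral_mul_lintegral_of_independent_measurableSpace (A.𝓕.le t) hle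
        (A.reward_indep _ hn).symm (hWm.indicator hsm) hgm]
    calc _ ≤ ∫⁻ ω, sᶜ.indicator W ω ∂P + (∫⁻ ω, s.indicator W ω ∂P) * 1 := by
          gcongr
          exact A.lintegral_exp_reward_le hν hn i l
      _ = ∫⁻ ω, W ω ∂P := by
          rw [mul_one, lintegral_indicator (A.𝓕.le t _ hsm.compl),
            lintegral_indicator (A.𝓕.le t _ hsm), add_comm,
            lintegral_add_compl _ (A.𝓕.le t _ hsm)]
      _ ≤ 1 := ih (by omega)

/-- Chernoff bound from the supermartingale; `σ = ±1` covers both tails. The pull count is fixed to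
`n` because the best exponent depends on it. -/
lemma measure_deviation_gt_le [IsProbabilityMeasure P] (A : Interaction ν T P)
    (hν : ∀ i, ∀ᵐ x ∂(ν i), x ∈ Set.Icc (0 : ℝ) 1) (i : Fin K) {t n : ℕ} (ht : t ≤ T)
    (hn : 0 < n) {Λ σ : ℝ} (hΛ : 0 ≤ Λ) (hσ : σ ^ 2 = 1) :
    P {ω | A.pulls t i ω = n ∧ 3 / 2 * √(Λ * n) < σ * A.deviation t i ω} ≤
      ENNReal.ofReal (Real.exp (-(9 / 2 * Λ))) := by
  have hn' : (0 : ℝ) < n := by exact_mod_cast hn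
  -- The minimizer of `-l · (3/2)√(Λn) + l² n/8`, with value `-9Λ + 9Λ/2`.
  set l : ℝ := 6 * √(Λ * n) / n with hl
  have hl0 : 0 ≤ l := by positivity
  have hsq : √(Λ * n) * √(Λ * n) = Λ * n := Real.mul_self_sqrt (by positivity)
  have hl2 : (σ * l) ^ 2 / 8 * n = 9 / 2 * Λ := by
    rw [mul_pow, hσ, hl]
    field_simp
    nlinarith
  have hl1 : l * (3 / 2 * √(Λ * n)) = 9 * Λ := by
    rw [hl]
    field_simp
    nlinarith
  have hsub : {ω | A.pulls t i ω = n ∧ 3 / 2 * √(Λ * n) < σ * A.deviation t i ω} ⊆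
      {ω | ENNReal.ofReal (Real.exp (9 / 2 * Λ)) ≤ ENNReal.ofReal
        (Real.exp (σ * l * A.deviation t i ω - (σ * l) ^ 2 / 8 * A.pulls t i ω))} := by
    rintro ω ⟨h1, h2⟩
    refine ENNReal.ofReal_le_ofReal (Real.exp_le_exp.2 ?_)
    rw [h1, hl2]
    have := mul_le_mul_of_nonneg_left h2.le hl0
    linarith
  refine (measure_mono hsub).trans ((meas_ge_le_lintegral_div ?_ ?_ ENNReal.ofReal_ne_top).trans ?_)
  · refine (ENNReal.measurable_ofReal.comp (Real.measurable_exp.comp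
      (Measurable.sub ?_ ?_))).aemeasurable
    · exact ((A.measurable_deviation ht i).mono (A.𝓕.le t) le_rfl).const_mul _
    · exact (measurable_from_top.comp
        ((A.measurable_pulls ht i).mono (A.𝓕.le t) le_rfl)).const_mul _
  · simp [Real.exp_pos]
  · rw [Real.exp_neg, ENNReal.ofReal_inv_of_pos (Real.exp_pos _), ENNReal.div_eq_inv_mul]
    exact mul_le_of_le_one_right' (A.lintegral_exp_deviation_le hν i _ ht)

/-- The event that after some round the empirical mean of the true rewards of `i` is far from the
expected reward. -/
def unconcentrated (A : Interaction ν T P) (Λ : ℝ) (i : Fin K) : Set Ω :=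
  {ω | ∃ t ≤ T, 3 / 2 * √(Λ * A.pulls t i ω) < |A.deviation t i ω|}

lemma deviation_eq_zero_of_pulls_eq_zero (A : Interaction ν T P) {t : ℕ} {i : Fin K} {ω : Ω}
    (h : A.pulls t i ω = 0) : A.deviation t i ω = 0 := by
  rw [pulls, Finset.card_eq_zero, Finset.filter_eq_empty_iff] at h
  exact Finset.sum_eq_zero fun n hn => if_neg (h hn)

lemma measurableSet_unconcentrated (A : Interaction ν T P) (Λ : ℝ) (i : Fin K) :
    MeasurableSet (A.unconcentrated Λ i) := by
  have : A.unconcentrated Λ i =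
      ⋃ t ∈ Finset.Iic T, {ω | 3 / 2 * √(Λ * A.pulls t i ω) < |A.deviation t i ω|} := by
    ext ω
    simp [unconcentrated]
  rw [this]
  refine Finset.measurableSet_biUnion _ fun t ht => ?_
  rw [Finset.mem_Iic] at ht
  have h1 : Measurable (A.deviation t i) := (A.measurable_deviation ht i).mono (A.𝓕.le t) le_rfl
  have h2 : Measurable fun ω => (A.pulls t i ω : ℝ) :=
    measurable_from_top.comp ((A.measurable_pulls ht i).mono (A.𝓕.le t) le_rfl)
  exact measurableSet_lt ((h2.const_mul _).sqrt.const_mul _) h1.abs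

/-- Union bound over the `T` rounds, the `T` possible pull counts and the two signs. -/
lemma measure_unconcentrated_le [IsProbabilityMeasure P] (A : Interaction ν T P)
    (hν : ∀ i, ∀ᵐ x ∂(ν i), x ∈ Set.Icc (0 : ℝ) 1) (i : Fin K) {Λ : ℝ} (hΛ : 0 ≤ Λ) :
    P.real (A.unconcentrated Λ i) ≤ 2 * (T : ℝ) ^ 2 * Real.exp (-(9 / 2 * Λ)) := by
  have hsub : A.unconcentrated Λ i ⊆ ⋃ p ∈ (Finset.Icc 1 T ×ˢ Finset.Icc 1 T) ×ˢ
      ({1, -1} : Finset ℝ), {ω | A.pulls p.1.1 i ω = p.1.2 ∧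
        3 / 2 * √(Λ * p.1.2) < p.2 * A.deviation p.1.1 i ω} := by
    rintro ω ⟨t, ht, h⟩
    -- Without pulls both sides of the strict inequality vanish, so the count `0` needs no term in
    -- the union.
    have hN : A.pulls t i ω ≠ 0 := by
      intro h0
      simp [A.deviation_eq_zero_of_pulls_eq_zero h0, h0] at h
    have hle := A.pulls_le t i ω
    have key : ∃ σ ∈ ({1, -1} : Finset ℝ), 3 / 2 * √(Λ * A.pulls t i ω) <
        σ * A.deviation t i ω := by
      rcases lt_abs.1 h with h | h
      · exact ⟨1, by simp, by simpa using h⟩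
      · exact ⟨-1, by simp, by simpa using h⟩
    obtain ⟨σ, hσ, hlt⟩ := key
    refine Set.mem_biUnion (x := ((t, A.pulls t i ω), σ)) ?_ ⟨rfl, hlt⟩
    simp only [Finset.coe_product, Set.mem_prod, Finset.mem_coe, Finset.mem_Icc]
    exact ⟨⟨⟨by omega, ht⟩, by omega, by omega⟩, hσ⟩
  refine ENNReal.toReal_le_of_le_ofReal (by positivity) ?_
  refine (measure_mono hsub).trans ((measure_biUnion_finset_le _ _).trans ?_)
  refine (Finset.sum_le_card_nsmul _ _ (ENNReal.ofReal (Real.exp (-(9 / 2 * Λ)))) ?_).trans ?_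
  · rintro ⟨⟨t, n⟩, σ⟩ hp
    simp only [Finset.mem_product, Finset.mem_Icc, Finset.mem_insert,
      Finset.mem_singleton] at hp
    exact A.measure_deviation_gt_le hν i hp.1.1.2 hp.1.2.1 hΛ
      (by rcases hp.2 with rfl | rfl <;> norm_num)
  · have hc : ((Finset.Icc 1 T ×ˢ Finset.Icc 1 T) ×ˢ ({1, -1} : Finset ℝ)).card = T * T * 2 := by
      simp [Finset.card_product, Finset.card_pair (show (1 : ℝ) ≠ -1 by norm_num)]
    rw [hc, nsmul_eq_mul, ← ENNReal.ofReal_natCast, ← ENNReal.ofReal_mul (by positivity)]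
    refine ENNReal.ofReal_le_ofReal (le_of_eq ?_)
    push_cast
    ring

/-! ### Regret as expected sum of gaps. -/

/-- The regret is the expected sum of the gaps of the chosen actions. -/
lemma regret_eq_integral [IsProbabilityMeasure P] (A : Interaction ν T P)
    (hν : ∀ i, ∀ᵐ x ∂(ν i), x ∈ Set.Icc (0 : ℝ) 1) :
    A.regret = ∫ ω, ∑ t ∈ Finset.Icc 1 T, gap ν (A.action t ω) ∂P := by
  have hfin : ∀ t ∈ Finset.Icc 1 T, ∀ f : Fin K → ℝ, Integrable (fun ω => f (A.action t ω)) P := by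
    intro t ht f
    have hm : Measurable fun ω => f (A.action t ω) :=
      measurable_from_top.comp ((A.measurable_action t ht).mono (A.𝓕.le _) le_rfl)
    refine Integrable.of_bound hm.aestronglyMeasurable (∑ i, ‖f i‖) (ae_of_all _ fun ω => ?_)
    exact Finset.single_le_sum (f := fun i => ‖f i‖) (fun _ _ => norm_nonneg _)
      (Finset.mem_univ _)
  have hsplit : ∀ t, A.trueReward t = fun ω => ∑ i,
      {ω | A.action t ω = i}.indicator (1 : Ω → ℝ) ω * A.reward t ω i := by
    intro t
    funext ω
    simp [trueReward, Set.indicator_apply]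
  have hrew : ∀ t ∈ Finset.Icc 1 T, ∀ i, Integrable (fun ω => A.reward t ω i) P := fun t ht i =>
    Integrable.of_mem_Icc 0 1
      ((A.measurable_reward_apply ht i).mono (A.𝓕.le t) le_rfl).aemeasurable
      (A.reward_mem_Icc hν ht i)
  have hint1 : ∀ t ∈ Finset.Icc 1 T, ∀ i, Integrable (fun ω =>
      {ω | A.action t ω = i}.indicator (1 : Ω → ℝ) ω * A.reward t ω i) P := by
    intro t ht i
    have : (fun ω => {ω | A.action t ω = i}.indicator (1 : Ω → ℝ) ω * A.reward t ω i) =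
        {ω | A.action t ω = i}.indicator fun ω => A.reward t ω i := by
      funext ω
      simp [Set.indicator_apply]
    rw [this]
    exact (hrew t ht i).indicator (A.𝓕.le _ _ (A.measurableSet_action_eq ht i))
  have hint : ∀ t ∈ Finset.Icc 1 T, Integrable (A.trueReward t) P := by
    intro t ht
    rw [hsplit]
    exact integrable_finsetSum _ fun i _ => hint1 t ht i
  have hround : ∀ t ∈ Finset.Icc 1 T, ∫ ω, A.trueReward t ω ∂P =
      ∫ ω, mean ν (A.action t ω) ∂P := by
    intro t ht
    have hmean : (fun ω => mean ν (A.action t ω)) = fun ω => ∑ i,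
        {ω | A.action t ω = i}.indicator (1 : Ω → ℝ) ω * mean ν i := by
      funext ω
      simp [Set.indicator_apply]
    have hind : ∀ i, Integrable ({ω | A.action t ω = i}.indicator (1 : Ω → ℝ)) P := fun i =>
      (integrable_const (1 : ℝ)).indicator (A.𝓕.le _ _ (A.measurableSet_action_eq ht i))
    rw [hsplit, hmean, integral_finsetSum _ fun i _ => hint1 t ht i,
      integral_finsetSum _ fun i _ => (hind i).mul_const _]
    refine Finset.sum_congr rfl fun i _ => ?_
    -- The choice of round `t` is determined by `𝓕 (t - 1)`, of which the reward vector of round `t`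
    -- is independent.
    have hI : IndepFun ({ω | A.action t ω = i}.indicator (1 : Ω → ℝ))
        (fun ω => A.reward t ω i) P := by
      refine indep_of_indep_of_le_left (indep_of_indep_of_le_right (A.reward_indep t ht).symm ?_) ?_
      · exact ((measurable_pi_apply i).comp (comap_measurable (A.reward t))).comap_le
      · have : Measurable[A.𝓕 (t - 1)] ({ω | A.action t ω = i}.indicator (1 : Ω → ℝ)) :=
          Measurable.indicator measurable_const (A.measurableSet_action_eq ht i)
        exact this.comap_le
    rw [hI.integral_fun_mul_eq_mul_integral (hind i).aestronglyMeasurable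
      (hrew t ht i).aestronglyMeasurable, A.integral_reward ht, integral_mul_const]
  rw [regret, integral_finsetSum _ hint, integral_finsetSum _ fun t ht => hfin t ht _,
    Finset.sum_congr rfl hround]
  have : ∀ t ∈ Finset.Icc 1 T, ∫ ω, gap ν (A.action t ω) ∂P =
      bestMean ν - ∫ ω, mean ν (A.action t ω) ∂P := by
    intro t ht
    unfold gap
    rw [integral_sub (integrable_const _) (hfin t ht _)]
    simp
  rw [Finset.sum_congr rfl this]
  simp

/-! ### Confidence bounds on the concentration event. -/

lemma IsUCB.pulls_pos {A : Interaction ν T P} (hA : A.IsUCB) {t : ℕ} (hK : K ≤ t) (ht : t ≤ T)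
    (i : Fin K) (ω : Ω) : 0 < A.pulls t i ω := by
  refine Finset.card_pos.2 ⟨i + 1, ?_⟩
  have hi := i.isLt
  have h := hA.roundRobin (i + 1) (Finset.mem_Icc.2 ⟨by omega, by omega⟩) (by omega) ω
  simp only [Finset.mem_filter, Finset.mem_Icc]
  exact ⟨⟨by omega, by omega⟩, Fin.ext (by omega)⟩

lemma IsUCB.pulls_eq_zero {A : Interaction ν T P} (hA : A.IsUCB) {t : ℕ} (ht : t ∈ Finset.Icc 1 T)
    (hK : t ≤ K) (ω : Ω) : A.pulls (t - 1) (A.action t ω) ω = 0 := by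
  rw [Finset.mem_Icc] at ht
  rw [pulls, Finset.card_eq_zero, Finset.filter_eq_empty_iff]
  intro n hn heq
  rw [Finset.mem_Icc] at hn
  have h1 := hA.roundRobin n (Finset.mem_Icc.2 ⟨by omega, by omega⟩) (by omega) ω
  have h2 := hA.roundRobin t (Finset.mem_Icc.2 ht) hK ω
  rw [heq] at h1
  omega

lemma sum_observed_eq (A : Interaction ν T P) (t : ℕ) (i : Fin K) (ω : Ω) :
    (∑ n ∈ Finset.Icc 1 t, if A.action n ω = i then A.observed n ω else 0) =
      A.pulls t i ω * mean ν i + A.deviation t i ω +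
        ∑ n ∈ Finset.Icc 1 t, if A.action n ω = i then A.noise n ω else 0 := by
  rw [pulls_eq_sum, deviation, Nat.cast_sum, Finset.sum_mul, ← Finset.sum_add_distrib,
    ← Finset.sum_add_distrib]
  refine Finset.sum_congr rfl fun n _ => ?_
  by_cases h : A.action n ω = i
  · simp [h, observed, trueReward]
  · simp [h]

lemma abs_sum_noise_le (A : Interaction ν T P) {t : ℕ} (ht : t ≤ T) (i : Fin K) (ω : Ω) :
    |∑ n ∈ Finset.Icc 1 t, if A.action n ω = i then A.noise n ω else 0| ≤ A.contamination ω := by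
  refine (Finset.abs_sum_le_sum_abs _ _).trans ?_
  refine (Finset.sum_le_sum fun n _ => ?_).trans (Finset.sum_le_sum_of_subset_of_nonneg
    (Finset.Icc_subset_Icc le_rfl ht) fun n _ _ => abs_nonneg (A.noise n ω))
  split_ifs <;> simp

/-- On the concentration event the empirical means of the observed rewards are accurate. -/
lemma abs_empMean_sub_mean_le (A : Interaction ν T P) {t : ℕ} (ht : t ≤ T) {i : Fin K} {ω : Ω}
    {Λ : ℝ} (hΛ : 0 ≤ Λ) (hω : ω ∉ A.unconcentrated Λ i) (hc : A.contamination ω ≤ Λ)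
    (hN : 0 < A.pulls t i ω) :
    |A.empMean t i ω - mean ν i| ≤
      3 / 2 * √(Λ / A.pulls t i ω) + Λ / A.pulls t i ω := by
  have hN' : (0 : ℝ) < A.pulls t i ω := by exact_mod_cast hN
  have hdev : |A.deviation t i ω| ≤ 3 / 2 * √(Λ * A.pulls t i ω) := by
    by_contra h
    exact hω ⟨t, ht, not_le.1 h⟩
  have hsqrt : √(Λ * A.pulls t i ω) = √(Λ / A.pulls t i ω) * A.pulls t i ω := by
    rw [Real.sqrt_eq_iff_mul_self_eq (by positivity) (by positivity), mul_mul_mul_comm,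
      Real.mul_self_sqrt (by positivity)]
    field_simp
  have heq : A.empMean t i ω - mean ν i = (A.deviation t i ω +
      ∑ n ∈ Finset.Icc 1 t, if A.action n ω = i then A.noise n ω else 0) / A.pulls t i ω := by
    rw [empMean, sum_observed_eq]
    field_simp
    ring
  rw [heq, abs_div, abs_of_pos hN', div_le_iff₀ hN']
  refine (abs_add_le _ _).trans ?_
  have h1 := (A.abs_sum_noise_le ht i ω).trans hc
  rw [hsqrt] at hdev
  have h2 : Λ / A.pulls t i ω * A.pulls t i ω = Λ := by field_simp
  linarith

/-- An action that is optimal has a large upper confidence bound. -/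
lemma bestMean_le_ucbIndex (A : Interaction ν T P) {t : ℕ} (ht : t ∈ Finset.Icc 1 T) {i : Fin K}
    {ω : Ω} {Λ : ℝ} (hΛ : 0 < Λ) (hω : ω ∉ A.unconcentrated Λ i) (hc : A.contamination ω ≤ Λ)
    (hobs : ∀ n ∈ Finset.Icc 1 T, 0 ≤ A.observed n ω) (hlog : Λ / 2 ≤ Real.log t)
    (hi : mean ν i ≤ 1) (hN : 0 < A.pulls (t - 1) i ω) :
    mean ν i ≤ A.ucbIndex t i ω := by
  rw [Finset.mem_Icc] at ht
  have hN' : (0 : ℝ) < A.pulls (t - 1) i ω := by exact_mod_cast hN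
  set x : ℝ := √(Λ / A.pulls (t - 1) i ω) with hx
  have hx0 : 0 ≤ x := Real.sqrt_nonneg _
  have hxx : x * x = Λ / A.pulls (t - 1) i ω := Real.mul_self_sqrt (by positivity)
  have hbonus : 2 * x ≤ √(8 * Real.log t / A.pulls (t - 1) i ω) := by
    refine Real.le_sqrt_of_sq_le ?_
    have : 4 * Λ / A.pulls (t - 1) i ω ≤ 8 * Real.log t / A.pulls (t - 1) i ω := by
      exact div_le_div_of_nonneg_right (by linarith) hN'.le
    calc (2 * x) ^ 2 = 4 * (x * x) := by ring
      _ = 4 * Λ / A.pulls (t - 1) i ω := by rw [hxx]; ring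
      _ ≤ _ := this
  unfold ucbIndex
  -- For `x ≥ 1/2` the bonus alone is at least 1 and observed rewards are nonnegative; otherwise `x²
  -- ≤ x/2`, so the error `3/2 x + x²` is at most `2x`.
  rcases le_total (1 / 2) x with h | h
  · have : 0 ≤ A.empMean (t - 1) i ω := by
      refine div_nonneg (Finset.sum_nonneg fun n hn => ?_) hN'.le
      rw [Finset.mem_Icc] at hn
      split_ifs
      · exact hobs n (Finset.mem_Icc.2 ⟨hn.1, by omega⟩)
      · exact le_rfl
    linarith
  · have := (abs_le.1 (A.abs_empMean_sub_mean_le (t := t - 1) (by omega) hΛ.le hω hc hN)).1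
    rw [← hx, ← hxx] at this
    nlinarith

/-- A suboptimal action is not chosen any more once it has been chosen often. -/
lemma IsUCB.pulls_action_le {A : Interaction ν T P} (hA : A.IsUCB) {t : ℕ}
    (ht : t ∈ Finset.Icc 1 T) {b : Fin K} {ω : Ω} {Λ : ℝ} (hΛ : 0 < Λ)
    (hω : ω ∉ A.unconcentrated Λ (A.action t ω)) (hb : ω ∉ A.unconcentrated Λ b)
    (hc : A.contamination ω ≤ Λ) (hobs : ∀ n ∈ Finset.Icc 1 T, 0 ≤ A.observed n ω)
    (hlog : Λ / 2 ≤ Real.log t) (hlog' : Real.log t ≤ Λ)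
    (hbest : mean ν b = bestMean ν) (hb1 : mean ν b ≤ 1)
    (hgap : 0 < gap ν (A.action t ω)) (hgap1 : gap ν (A.action t ω) ≤ 1) :
    (A.pulls (t - 1) (A.action t ω) ω : ℝ) ≤ 36 * Λ / gap ν (A.action t ω) ^ 2 := by
  -- In the round-robin phase the chosen action has no earlier pulls.
  rcases le_or_gt t K with hK | hK
  · rw [hA.pulls_eq_zero ht hK]
    simp only [CharP.cast_eq_zero]
    positivity
  have htT := Finset.mem_Icc.1 ht
  have h1 := A.bestMean_le_ucbIndex ht hΛ hb hc hobs hlog hb1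
    (hA.pulls_pos (by omega) (by omega) b ω)
  have h2 := hA.argmax t ht hK ω b
  generalize A.action t ω = i at *
  have hN := hA.pulls_pos (t := t - 1) (by omega) (by omega) i ω
  have hN' : (0 : ℝ) < A.pulls (t - 1) i ω := by exact_mod_cast hN
  have h3 := (abs_le.1 (A.abs_empMean_sub_mean_le (t := t - 1) (by omega) hΛ.le hω hc hN)).2
  unfold ucbIndex at h1 h2
  set x : ℝ := √(Λ / A.pulls (t - 1) i ω) with hx
  have hx0 : 0 ≤ x := Real.sqrt_nonneg _
  have hxx : x * x = Λ / A.pulls (t - 1) i ω := Real.mul_self_sqrt (by positivity)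
  have hbonus : √(8 * Real.log t / A.pulls (t - 1) i ω) ≤ 3 * x := by
    refine Real.sqrt_le_iff.2 ⟨by positivity, ?_⟩
    calc 8 * Real.log t / A.pulls (t - 1) i ω ≤ 9 * Λ / A.pulls (t - 1) i ω := by
          gcongr
          linarith
      _ = 9 * (x * x) := by rw [hxx]; ring
      _ = _ := by ring
  by_contra hlt
  rw [not_le, div_lt_iff₀ (by positivity)] at hlt
  -- As `Δ ≤ 1` this gives `x < 1/6`, so the index exceeds the mean by at most `3x + 3/2 x + x² ≤ 6x
  -- < Δ` and stays below the best mean, a contradiction.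
  have hx6 : 6 * x < gap ν i := by
    refine lt_of_pow_lt_pow_left₀ 2 hgap.le ?_
    have : x * x * A.pulls (t - 1) i ω = Λ := by rw [hxx]; field_simp
    nlinarith
  rw [← hxx] at h3
  have hg : gap ν i = bestMean ν - mean ν i := rfl
  nlinarith

/-! ### Counting late pulls and summing the regret. -/

/-- The number of rounds from round `s` on in which action `i` is chosen. -/
noncomputable def latePulls (A : Interaction ν T P) (s : ℝ) (i : Fin K) (ω : Ω) : ℕ :=
  ((Finset.Icc 1 T).filter fun t : ℕ => s ≤ (t : ℝ) ∧ A.action t ω = i).card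

lemma latePulls_le_horizon (A : Interaction ν T P) (s : ℝ) (i : Fin K) (ω : Ω) :
    A.latePulls s i ω ≤ T := by
  simpa [latePulls] using
    Finset.card_filter_le (Finset.Icc 1 T) (fun t : ℕ => s ≤ (t : ℝ) ∧ A.action t ω = i)

lemma latePulls_le_of_pulls_le (A : Interaction ν T P) {s B : ℝ} {i : Fin K} {ω : Ω} (hB : 0 ≤ B)
    (h : ∀ t ∈ Finset.Icc 1 T, s ≤ (t : ℝ) → A.action t ω = i → (A.pulls (t - 1) i ω : ℝ) ≤ B) :
    (A.latePulls s i ω : ℝ) ≤ B + 1 := by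
  rcases ((Finset.Icc 1 T).filter fun t : ℕ => s ≤ (t : ℝ) ∧ A.action t ω = i).eq_empty_or_nonempty
    with he | hne
  · rw [latePulls, he]
    simp only [Finset.card_empty, CharP.cast_eq_zero]
    linarith
  -- Apply the hypothesis at the last late pull: all other late pulls precede it, and it contributes
  -- the extra 1.
  · have hmem := Finset.max'_mem _ hne
    set m := Finset.max' _ hne with hm
    rw [Finset.mem_filter] at hmem
    have h1 := h m hmem.1 hmem.2.1 hmem.2.2
    have hm1 := (Finset.mem_Icc.1 hmem.1).1
    have h2 : A.latePulls s i ω ≤ A.pulls (m - 1 + 1) i ω := by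
      refine Finset.card_le_card fun n hn => ?_
      have hle : n ≤ m := Finset.le_max' _ n hn
      simp only [Finset.mem_filter, Finset.mem_Icc] at hn ⊢
      exact ⟨⟨hn.1.1, by omega⟩, hn.2.2⟩
    rw [pulls_succ, if_pos (by rw [Nat.sub_add_cancel hm1]; exact hmem.2.2)] at h2
    have h3 : (A.latePulls s i ω : ℝ) ≤ A.pulls (m - 1) i ω + 1 := by exact_mod_cast h2
    linarith

/-- There are at most `⌊s⌋` rounds before `s`, each charged the largest gap; the later ones are
grouped by action. -/
lemma sum_gap_action_le (A : Interaction ν T P) {s : ℝ} (hs : 0 ≤ s) (ω : Ω) :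
    ∑ t ∈ Finset.Icc 1 T, gap ν (A.action t ω) ≤
      s * (⨆ i, gap ν i) + ∑ i ∈ Finset.univ.filter (fun i => 0 < gap ν i),
        gap ν i * A.latePulls s i ω := by
  rw [← Finset.sum_filter_not_add_sum_filter (Finset.Icc 1 T) (fun t : ℕ => s ≤ (t : ℝ))]
  refine add_le_add ?_ (le_of_eq ?_)
  · refine (Finset.sum_le_card_nsmul _ _ _ fun t _ => gap_le_iSup ν (A.action t ω)).trans ?_
    rw [nsmul_eq_mul]
    refine mul_le_mul_of_nonneg_right ?_ (iSup_gap_nonneg ν)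
    have : (Finset.Icc 1 T).filter (fun t : ℕ => ¬ s ≤ (t : ℝ)) ⊆ Finset.Icc 1 ⌊s⌋₊ := by
      intro t ht
      simp only [Finset.mem_filter, Finset.mem_Icc, not_le] at ht ⊢
      exact ⟨ht.1.1, Nat.le_floor ht.2.le⟩
    refine (Nat.cast_le.2 (Finset.card_le_card this)).trans ?_
    simpa using Nat.floor_le hs
  · rw [← Finset.sum_fiberwise _ (fun t => A.action t ω), Finset.sum_filter]
    refine Finset.sum_congr rfl fun i _ => ?_
    rw [Finset.sum_congr rfl (g := fun _ => gap ν i)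
      (fun t ht => by rw [(Finset.mem_filter.1 ht).2]), Finset.sum_const, nsmul_eq_mul,
      Finset.filter_filter, latePulls]
    split_ifs with h
    · ring
    · rw [le_antisymm (not_lt.1 h) (gap_nonneg ν i), mul_zero]

lemma measurable_latePulls (A : Interaction ν T P) (s : ℝ) (i : Fin K) :
    Measurable (A.latePulls s i) := by
  have : A.latePulls s i = fun ω => ∑ n ∈ Finset.Icc 1 T,
      if s ≤ (n : ℝ) ∧ A.action n ω = i then 1 else 0 :=
    funext fun ω => Finset.card_filter _ _
  rw [this]
  refine Finset.measurable_fun_sum _ fun n hn => Measurable.ite ?_ measurable_const measurable_const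
  exact (MeasurableSet.const _).inter (A.𝓕.le _ _ (A.measurableSet_action_eq hn i))

lemma integrable_latePulls [IsProbabilityMeasure P] (A : Interaction ν T P) (s : ℝ) (i : Fin K) :
    Integrable (fun ω => (A.latePulls s i ω : ℝ)) P := by
  have hm : Measurable fun ω => (A.latePulls s i ω : ℝ) :=
    measurable_from_top.comp (A.measurable_latePulls s i)
  refine Integrable.of_bound hm.aestronglyMeasurable T (ae_of_all _ fun ω => ?_)
  simpa using A.latePulls_le_horizon s i ω

lemma regret_nonneg [IsProbabilityMeasure P] (A : Interaction ν T P)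
    (hν : ∀ i, ∀ᵐ x ∂(ν i), x ∈ Set.Icc (0 : ℝ) 1) : 0 ≤ A.regret := by
  rw [A.regret_eq_integral hν]
  exact integral_nonneg fun ω => Finset.sum_nonneg fun t _ => gap_nonneg ν _

lemma IsUCB.integral_latePulls_le [IsProbabilityMeasure P] {A : Interaction ν T P} (hA : A.IsUCB)
    (hp : ∀ i, IsProbabilityMeasure (ν i)) (hν : ∀ i, ∀ᵐ x ∂(ν i), x ∈ Set.Icc (0 : ℝ) 1)
    (hT : 1 ≤ Real.log T) (hc : ∀ᵐ ω ∂P, A.contamination ω ≤ Real.log T) {s : ℝ} (hs : √T ≤ s)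
    {i : Fin K} (hi : 0 < gap ν i) :
    ∫ ω, (A.latePulls s i ω : ℝ) ∂P ≤ 36 * Real.log T / gap ν i ^ 2 + 5 := by
  have : Nonempty (Fin K) := ⟨i⟩
  obtain ⟨b, hb⟩ : ∃ b, mean ν b = bestMean ν := exists_eq_ciSup_of_finite
  set Λ := Real.log T with hΛ
  have hΛ0 : 0 < Λ := by linarith
  have hT0 : (0 : ℝ) < T := by
    rcases Nat.eq_zero_or_pos T with h | h
    · simp [hΛ, h] at hΛ0
    · exact_mod_cast h
  -- Failure of concentration costs at most `T` pulls with probability at most `2T² · T⁻³`; the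
  -- exponent `9/2` is weakened to `3`.
  have hsmall : ∀ j, T * P.real (A.unconcentrated Λ j) ≤ 2 := by
    intro j
    have h := A.measure_unconcentrated_le hν j hΛ0.le
    have h3 : Real.exp (-(9 / 2 * Λ)) ≤ ((T : ℝ) ^ 3)⁻¹ := by
      calc Real.exp (-(9 / 2 * Λ)) ≤ Real.exp (-(3 * Λ)) := Real.exp_le_exp.2 (by linarith)
        _ = ((T : ℝ) ^ 3)⁻¹ := by
          rw [Real.exp_neg, show (3 : ℝ) * Λ = ((3 : ℕ) : ℝ) * Λ by norm_num, Real.exp_nat_mul,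
            hΛ, Real.exp_log hT0]
    calc T * P.real (A.unconcentrated Λ j) ≤ T * (2 * (T : ℝ) ^ 2 * ((T : ℝ) ^ 3)⁻¹) := by
          gcongr
          exact h.trans (by gcongr)
      _ = 2 := by field_simp
  -- Only the chosen action `i` and one optimal action `b` need to concentrate. The final constant
  -- is `5 = 1 + 2 + 2`.
  have hbd : ∀ᵐ ω ∂P, (A.latePulls s i ω : ℝ) ≤ 36 * Λ / gap ν i ^ 2 + 1 +
      ((A.unconcentrated Λ i).indicator (fun _ => (T : ℝ)) ω +
        (A.unconcentrated Λ b).indicator (fun _ => (T : ℝ)) ω) := by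
    have hobs : ∀ᵐ ω ∂P, ∀ n ∈ Finset.Icc 1 T, 0 ≤ A.observed n ω := by
      rw [eventually_all_finset]
      exact fun n hn => (A.observed_mem n hn).mono fun ω h => h.1
    filter_upwards [hc, hobs] with ω hcω hobsω
    have hI : 0 ≤ (A.unconcentrated Λ i).indicator (fun _ => (T : ℝ)) ω :=
      Set.indicator_nonneg (fun _ _ => hT0.le) _
    have hB : 0 ≤ (A.unconcentrated Λ b).indicator (fun _ => (T : ℝ)) ω :=
      Set.indicator_nonneg (fun _ _ => hT0.le) _
    have hmain : 0 ≤ 36 * Λ / gap ν i ^ 2 := by positivity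
    have hle : (A.latePulls s i ω : ℝ) ≤ T := by exact_mod_cast A.latePulls_le_horizon s i ω
    by_cases h1 : ω ∈ A.unconcentrated Λ i
    · rw [Set.indicator_of_mem h1] at hI ⊢
      linarith
    by_cases h2 : ω ∈ A.unconcentrated Λ b
    · rw [Set.indicator_of_mem h2] at hB ⊢
      linarith
    refine (A.latePulls_le_of_pulls_le hmain fun t ht hst hat => ?_).trans (by linarith)
    subst hat
    have ht0 : (0 : ℝ) < t := by exact_mod_cast (Finset.mem_Icc.1 ht).1
    refine hA.pulls_action_le ht hΛ0 h1 h2 hcω hobsω ?_ ?_ hb (mean_mem_Icc hp hν b).2 hi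
      (gap_le_one hp hν _)
    · rw [hΛ, ← Real.log_sqrt hT0.le]
      exact Real.log_le_log (Real.sqrt_pos.2 hT0) (hs.trans hst)
    · exact Real.log_le_log ht0 (by exact_mod_cast (Finset.mem_Icc.1 ht).2)
  have hind : ∀ j, Integrable ((A.unconcentrated Λ j).indicator (fun _ => (T : ℝ))) P := fun j =>
    (integrable_const _).indicator (A.measurableSet_unconcentrated Λ j)
  refine (integral_mono_ae (A.integrable_latePulls s i)
    ((integrable_const _).add ((hind i).add (hind b))) hbd).trans ?_
  simp only [Pi.add_apply]
  rw [integral_add (g := fun ω => _ + _) (integrable_const _) ((hind i).add (hind b)),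
    integral_add (hind i) (hind b),
    integral_indicator_const _ (A.measurableSet_unconcentrated Λ i),
    integral_indicator_const _ (A.measurableSet_unconcentrated Λ b)]
  have h1 := hsmall i
  have h2 := hsmall b
  simp only [integral_const, probReal_univ, smul_eq_mul, one_mul]
  linarith

/-- The regret bound of UCB when the contamination is at most logarithmic. -/
lemma IsUCB.regret_le [IsProbabilityMeasure P] {A : Interaction ν T P} (hA : A.IsUCB)
    (hp : ∀ i, IsProbabilityMeasure (ν i)) (hν : ∀ i, ∀ᵐ x ∂(ν i), x ∈ Set.Icc (0 : ℝ) 1)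
    (hT : 1 ≤ Real.log T) (hc : ∀ᵐ ω ∂P, A.contamination ω ≤ Real.log T) {s : ℝ} (hs : √T ≤ s) :
    A.regret ≤ 41 * (s * (⨆ i, gap ν i) +
      ∑ i ∈ Finset.univ.filter (fun i => 0 < gap ν i), Real.log T / gap ν i) := by
  have hs0 : 0 ≤ s := (Real.sqrt_nonneg _).trans hs
  have hint := fun i => (A.integrable_latePulls s i).const_mul (gap ν i)
  have hint' := integrable_finsetSum (Finset.univ.filter fun i => 0 < gap ν i)
    fun i _ => hint i
  rw [A.regret_eq_integral hν]
  have h := integral_mono_of_nonneg (ae_of_all P fun ω =>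
    Finset.sum_nonneg fun t (_ : t ∈ Finset.Icc 1 T) => gap_nonneg ν (A.action t ω))
    ((integrable_const (s * ⨆ i, gap ν i)).add hint')
    (ae_of_all P fun ω => A.sum_gap_action_le hs0 ω)
  refine h.trans ?_
  simp only [Pi.add_apply]
  rw [integral_add (integrable_const _) hint', integral_finsetSum _ fun i _ => hint i, mul_add]
  refine add_le_add ?_ ?_
  · simp only [integral_const, probReal_univ, smul_eq_mul, one_mul]
    linarith [mul_nonneg hs0 (iSup_gap_nonneg ν)]
  · rw [Finset.mul_sum]
    refine Finset.sum_le_sum fun i hi => ?_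
    have hi : 0 < gap ν i := (Finset.mem_filter.1 hi).2
    have h1 := gap_le_one hp hν i
    rw [integral_const_mul]
    refine (mul_le_mul_of_nonneg_left (hA.integral_latePulls_le hp hν hT hc hs hi) hi.le).trans ?_
    -- From `gap ≤ 1 ≤ log T`; it absorbs the additive 5, whence `41 = 36 + 5`.
    have h5 : gap ν i ≤ Real.log T / gap ν i := by
      rw [le_div_iff₀ hi]
      nlinarith
    have h36 : gap ν i * (36 * Real.log T / gap ν i ^ 2) = 36 * (Real.log T / gap ν i) := by
      field_simp
    rw [mul_add, h36]
    linarith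

end Interaction

/-! ### Asymptotic consequences and the theorem. -/

/-- UCB has sublinear regret when the contamination is eventually at most logarithmic. -/
lemma isLittleO_regret {K : ℕ} {ν : Fin K → Measure ℝ} (hp : ∀ i, IsProbabilityMeasure (ν i))
    (hν : ∀ i, ∀ᵐ x ∂(ν i), x ∈ Set.Icc (0 : ℝ) 1) {Ω : ℕ → Type*} [∀ T, MeasurableSpace (Ω T)]
    {P : ∀ T, Measure (Ω T)} [∀ T, IsProbabilityMeasure (P T)]
    (A : ∀ T : ℕ, Interaction ν T (P T)) (hA : ∀ T, (A T).IsUCB)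
    (hc : ∀ᶠ T : ℕ in atTop, ∀ᵐ ω ∂(P T), (A T).contamination ω ≤ Real.log T) :
    (fun T : ℕ => (A T).regret) =o[atTop] (fun T : ℕ => (T : ℝ)) := by
  have hlog : ∀ᶠ T : ℕ in atTop, 1 ≤ Real.log T :=
    (Real.tendsto_log_atTop.comp tendsto_natCast_atTop_atTop).eventually_ge_atTop 1
  have hsqrt : (fun x : ℝ => √x) =o[atTop] (fun x : ℝ => x) := by
    refine isLittleO_of_tendsto' ?_ ?_
    · filter_upwards [eventually_gt_atTop 0] with x hx h0 using absurd h0 hx.ne'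
    · simp only [Real.sqrt_div_self]
      exact tendsto_inv_atTop_zero.comp Real.tendsto_sqrt_atTop
  have hO : (fun x : ℝ => 41 * (√x * (⨆ i, gap ν i) +
      ∑ i ∈ Finset.univ.filter (fun i => 0 < gap ν i), Real.log x / gap ν i)) =o[atTop]
      (fun x : ℝ => x) := by
    have h1 : (fun x : ℝ => √x * (⨆ i, gap ν i)) =o[atTop] (fun x : ℝ => x) := by
      simpa only [mul_comm] using hsqrt.const_mul_left (⨆ i, gap ν i)
    have h2 : (fun x : ℝ => ∑ i ∈ Finset.univ.filter (fun i => 0 < gap ν i),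
        Real.log x / gap ν i) =o[atTop] (fun x : ℝ => x) := by
      refine IsLittleO.fun_sum fun i _ => ?_
      simp only [div_eq_inv_mul]
      exact Real.isLittleO_log_id_atTop.const_mul_left (gap ν i)⁻¹
    exact (h1.add h2).const_mul_left 41
  refine IsBigO.trans_isLittleO ?_ (hO.comp_tendsto tendsto_natCast_atTop_atTop)
  refine IsBigO.of_bound 1 ?_
  filter_upwards [hlog, hc] with T hT hcT
  have h := (hA T).regret_le hp hν hT hcT le_rfl
  rw [Real.norm_of_nonneg ((A T).regret_nonneg hν), one_mul]
  exact h.trans (le_abs_self _)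

lemma not_successfulAttack_of_isLittleO {R : ℕ → ℝ}
    (hR : R =o[atTop] (fun T : ℕ => (T : ℝ))) : ¬ SuccessfulAttack R := by
  rintro ⟨c, hc, h⟩
  obtain ⟨T, h1, h2, h3⟩ :=
    (h.and ((hR.bound (half_pos hc)).and (eventually_gt_atTop 0))).exists
  have hT : (0 : ℝ) < T := by exact_mod_cast h3
  rw [Real.norm_of_nonneg hT.le] at h2
  have := (le_abs_self _).trans h2
  nlinarith [mul_pos hc hT]

end PoisonedBandit

theorem theorem1 :
    -- the regret bound, with a universal constant
    (∃ c₁ : ℝ, 0 < c₁ ∧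
      ∀ (ε α : ℝ), 0 < ε → ε < 1 → 0 < α → ε * α ≤ 1 / 2 →
      ∀ (K : ℕ) (ν : Fin K → Measure ℝ), (∀ i, IsProbabilityMeasure (ν i)) →
        (∀ i, ∀ᵐ x ∂(ν i), x ∈ Set.Icc (0 : ℝ) 1) →
      ∀ (t₀ : ℝ), 36 * (K : ℝ) ^ 2 ≤ t₀ / (Real.log t₀) ^ 2 →
      ∀ (T : ℕ), max (t₀ ^ (1 / (1 - α * ε))) (Real.exp ((4 : ℝ) ^ α)) < (T : ℝ) →
      ∀ (Ω : Type*) [MeasurableSpace Ω] (P : Measure Ω) [IsProbabilityMeasure P]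
        (A : PoisonedBandit.Interaction ν T P), A.IsUCB →
        (∀ᵐ ω ∂P, A.contamination ω ≤ (Real.log (T : ℝ)) ^ (1 - ε)) →
        A.regret ≤ c₁ * ((T : ℝ) ^ (1 - α * ε) * (⨆ i, PoisonedBandit.gap ν i) +
          ∑ i ∈ Finset.univ.filter (fun i => 0 < PoisonedBandit.gap ν i),
            Real.log (T : ℝ) / PoisonedBandit.gap ν i)) ∧
    -- sublinear regret under contamination at most `(log T) ^ (1 - ε)`
    (∀ (ε : ℝ), 0 < ε → ε < 1 →
      ∀ (K : ℕ) (ν : Fin K → Measure ℝ), (∀ i, IsProbabilityMeasure (ν i)) →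
        (∀ i, ∀ᵐ x ∂(ν i), x ∈ Set.Icc (0 : ℝ) 1) →
      ∀ (Ω : ℕ → Type*) [∀ T, MeasurableSpace (Ω T)] (P : ∀ T, Measure (Ω T))
        [∀ T, IsProbabilityMeasure (P T)]
        (A : ∀ T : ℕ, PoisonedBandit.Interaction ν T (P T)), (∀ T, (A T).IsUCB) →
        (∀ᶠ T : ℕ in atTop,
          ∀ᵐ ω ∂(P T), (A T).contamination ω ≤ (Real.log (T : ℝ)) ^ (1 - ε)) →
        (fun T : ℕ => (A T).regret) =o[atTop] (fun T : ℕ => (T : ℝ))) ∧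
    -- attacks with contamination `o(log T)` leave the regret sublinear, so they do not succeed
    (∀ (C : ℕ → ℝ), C =o[atTop] (fun T : ℕ => Real.log (T : ℝ)) →
      ∀ (K : ℕ) (ν : Fin K → Measure ℝ), (∀ i, IsProbabilityMeasure (ν i)) →
        (∀ i, ∀ᵐ x ∂(ν i), x ∈ Set.Icc (0 : ℝ) 1) →
      ∀ (Ω : ℕ → Type*) [∀ T, MeasurableSpace (Ω T)] (P : ∀ T, Measure (Ω T))
        [∀ T, IsProbabilityMeasure (P T)]
        (A : ∀ T : ℕ, PoisonedBandit.Interaction ν T (P T)), (∀ T, (A T).IsUCB) →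
        (∀ᶠ T : ℕ in atTop, ∀ᵐ ω ∂(P T), (A T).contamination ω ≤ C T) →
        (fun T : ℕ => (A T).regret) =o[atTop] (fun T : ℕ => (T : ℝ)) ∧
          ¬ PoisonedBandit.SuccessfulAttack (fun T : ℕ => (A T).regret)) := by
  have hlog_le : ∀ (ε : ℝ), 0 < ε → ∀ T : ℕ, 1 ≤ Real.log T →
      Real.log (T : ℝ) ^ (1 - ε) ≤ Real.log T := fun ε hε T hT => by
    simpa using Real.rpow_le_rpow_of_exponent_le hT (show 1 - ε ≤ 1 by linarith)
  have hlog : ∀ᶠ T : ℕ in atTop, 1 ≤ Real.log T :=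
    (Real.tendsto_log_atTop.comp tendsto_natCast_atTop_atTop).eventually_ge_atTop 1
  refine ⟨⟨41, by norm_num, ?_⟩, ?_, ?_⟩
  · intro ε α hε _ hα hεα K ν hp hν t₀ _ T hT Ω _ P _ A hA hc
    -- Since `4^α ≥ 1`, the lower bound on `T` gives `log T ≥ 1`, so that `(log T)^(1-ε) ≤ log T`.
    have hexp : Real.exp 1 ≤ T :=
      (Real.exp_le_exp.2 (Real.one_le_rpow (by norm_num) hα.le)).trans
        ((le_max_right _ _).trans hT.le)
    have hT0 : (0 : ℝ) < T := (Real.exp_pos 1).trans_le hexp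
    have hT1 : 1 ≤ Real.log T := (Real.le_log_iff_exp_le hT0).2 hexp
    refine hA.regret_le hp hν hT1 (hc.mono fun ω h => h.trans (hlog_le ε hε T hT1)) ?_
    -- `αε ≤ 1/2` is what puts the threshold `T^(1-αε)` above `√T`.
    rw [Real.sqrt_eq_rpow]
    exact Real.rpow_le_rpow_of_exponent_le ((Real.one_le_exp zero_le_one).trans hexp)
      (by linarith)
  · intro ε hε _ K ν hp hν Ω _ P _ A hA hc
    refine PoisonedBandit.isLittleO_regret hp hν A hA ?_
    filter_upwards [hc, hlog] with T hT hT1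
    exact hT.mono fun ω h => h.trans (hlog_le ε hε T hT1)
  · intro C hC K ν hp hν Ω _ P _ A hA hc
    have hR : (fun T : ℕ => (A T).regret) =o[atTop] (fun T : ℕ => (T : ℝ)) := by
      refine PoisonedBandit.isLittleO_regret hp hν A hA ?_
      filter_upwards [hc, hlog, hC.bound one_pos] with T hT hT1 hCT
      rw [one_mul, Real.norm_of_nonneg (zero_le_one.trans hT1)] at hCT
      exact hT.mono fun ω h => h.trans ((le_abs_self _).trans hCT)
    exact ⟨hR, PoisonedBandit.not_successfulAttack_of_isLittleO hR⟩
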